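/- Let $\mathsf k$ be an algebraically closed field of characteristic $p>0$, let $n\ge 3$ and $e\ge 1$ be integers, and put $d=pe-2$. A projective $1$-form of degree $d+2$ is a homogeneous polynomial $1$-form $\omega=\sum_{i=0}^n a_i\,dx_i$ on $\mathbb A^{n+1}_{\mathsf k}$ whose coefficients $a_i\in\mathsf k[x_0,\dots,x_n]$ are homogeneous of degree $d+1$ and satisfy $\sum_i x_i a_i=0$; these forms constitute the vector space $H^0(\mathbb P^n_{\mathsf k},\Omega^1_{\mathbb P^n_{\mathsf k}}(d+2))$. Let $\mathrm{Fol}_d(\mathbb P^n_{\mathsf k})$ be the scheme of codimension one foliations of degree $d$ on $\mathbb P^n_{\mathsf k}$, that is, the locally closed subscheme of the projective space $\mathbb P H^0(\mathbb P^n_{\mathsf k},\Omega^1_{\mathbb P^n_{\mathsf k}}(d+2))$ of lines in this vector space which is defined by the equations $\omega\wedge d\omega=0$ and by the open condition that the zero set of $\omega$ has codimension at least two. Then the set $\mathrm{Closed}_{d}(\mathbb P^n_{\mathsf k})$ of points of $\mathrm{Fol}_{d}(\mathbb P^n_{\mathsf k})$ defined by closed forms ($d\omega=0$) is an irreducible component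 of $\mathrm{Fol}_{d}(\mathbb P^n_{\mathsf k})$, and it is an open subset of the projectivization of the vector space of closed projective $1$-forms of degree $pe$ on $\mathbb A^{n+1}_{\mathsf k}$. Moreover, $\mathrm{Fol}_{d}(\mathbb P^n_{\mathsf k})$ is generically reduced along $\mathrm{Closed}_{d}(\mathbb P^n_{\mathsf k})$: there is an open subset of $\mathrm{Fol}_d(\mathbb P^n_{\mathsf k})$ which meets $\mathrm{Closed}_{d}(\mathbb P^n_{\mathsf k})$ and at every point of which the local ring of $\mathrm{Fol}_d(\mathbb P^n_{\mathsf k})$ is reduced. -/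

import Mathlib

open AlgebraicGeometry CategoryTheory
universe u
namespace Foliation
noncomputable section

section Quotient
variable {k : Type u} [Field k] {A : Type u} [CommRing A] [Algebra k A]
  (𝒜 : ℕ → Submodule k A) [GradedAlgebra 𝒜] (I : HomogeneousIdeal 𝒜)

/-- The grading on the quotient of a graded algebra by a homogeneous ideal. -/
def quotGrading (i : ℕ) : Submodule k (A ⧸ I.toIdeal) :=
  (𝒜 i).map (Ideal.Quotient.mkₐ k I.toIdeal).toLinearMap

instance quotGrading_gradedMonoid : SetLike.GradedMonoid (quotGrading 𝒜 I) where
  one_mem := ⟨1, SetLike.GradedOne.one_mem, map_one (Ideal.Quotient.mk I.toIdeal)⟩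
  mul_mem := by
    rintro i j _ _ ⟨a, ha, rfl⟩ ⟨b, hb, rfl⟩
    exact ⟨a * b, SetLike.GradedMul.mul_mem ha hb, map_mul (Ideal.Quotient.mk I.toIdeal) a b⟩

/-- The projection of a graded piece onto the corresponding graded piece of the quotient. -/
def quotPiece (i : ℕ) : 𝒜 i →ₗ[k] quotGrading 𝒜 I i :=
  (Ideal.Quotient.mkₐ k I.toIdeal).toLinearMap.restrict fun a ha => ⟨a, ha, rfl⟩

/-- The classes of the homogeneous components of an element. -/
def quotComponents : A →ₗ[k] DirectSum ℕ fun i => quotGrading 𝒜 I i :=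
  (DFinsupp.mapRange.linearMap (quotPiece 𝒜 I)).comp
    (DirectSum.decomposeLinearEquiv 𝒜).toLinearMap

theorem quotComponents_eq_zero (a : A) (ha : a ∈ I.toIdeal) : quotComponents 𝒜 I a = 0 :=
  DFinsupp.ext fun i => Subtype.ext (Ideal.Quotient.eq_zero_iff_mem.2 (I.isHomogeneous i ha))

/-- The decomposition of a class into the classes of its homogeneous components. -/
def quotDecompose : (A ⧸ I.toIdeal) →+ DirectSum ℕ fun i => quotGrading 𝒜 I i :=
  QuotientAddGroup.lift (Submodule.toAddSubgroup I.toIdeal)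
    (quotComponents 𝒜 I).toAddMonoidHom (quotComponents_eq_zero 𝒜 I)

theorem quotDecompose_of (i : ℕ) (x : quotGrading 𝒜 I i) :
    quotDecompose 𝒜 I x = DirectSum.of (fun i => quotGrading 𝒜 I i) i x := by
  classical
  obtain ⟨_, a, ha, rfl⟩ := x
  change DFinsupp.mapRange.linearMap (quotPiece 𝒜 I) (DirectSum.decompose 𝒜 a) = _
  rw [DirectSum.decompose_of_mem 𝒜 ha]
  exact DFinsupp.mapRange_single (hf := fun i => map_zero (quotPiece 𝒜 I i))

instance quotGrading_gradedAlgebra : GradedAlgebra (quotGrading 𝒜 I) where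
  decompose' := quotDecompose 𝒜 I
  left_inv := by
    intro x
    obtain ⟨a, rfl⟩ := Ideal.Quotient.mk_surjective x
    induction a using DirectSum.Decomposition.inductionOn 𝒜 with
    | zero => simp
    | @homogeneous i m =>
      have := quotDecompose_of 𝒜 I i ⟨Ideal.Quotient.mk I.toIdeal m, m, m.2, rfl⟩
      simp only at this
      rw [this, DirectSum.coeAddMonoidHom_of]
    | add a b ha hb => rw [map_add, map_add, map_add, ha, hb]
  right_inv := by
    intro x
    induction x using DirectSum.induction_on with
    | zero => simp
    | of i x => rw [DirectSum.coeAddMonoidHom_of, quotDecompose_of]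
    | add a b ha hb => rw [map_add, map_add, ha, hb]

/-- The quotient map, as a homomorphism of graded rings. -/
def quotMap : GradedRingHom 𝒜 (quotGrading 𝒜 I) where
  toRingHom := Ideal.Quotient.mk I.toIdeal
  map_mem {_ a} ha := ⟨a, ha, rfl⟩

theorem quotMap_irrelevant :
    HomogeneousIdeal.irrelevant (quotGrading 𝒜 I) ≤
      (HomogeneousIdeal.irrelevant 𝒜).map (quotMap 𝒜 I) := by
  rw [HomogeneousIdeal.irrelevant_le]
  rintro i hi
  rintro _ ⟨a, ha, rfl⟩
  exact Ideal.mem_map_of_mem (quotMap 𝒜 I)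
    (HomogeneousIdeal.mem_irrelevant_of_mem 𝒜 hi ha)

/-- The closed subscheme of `Proj A` defined by a homogeneous ideal `I`, that is `Proj (A / I)`. -/
abbrev closedSub : Scheme.{u} := Proj (quotGrading 𝒜 I)

/-- The closed immersion of `Proj (A / I)` into `Proj A`. -/
def closedSubι : closedSub 𝒜 I ⟶ Proj 𝒜 := Proj.map (quotMap 𝒜 I) (quotMap_irrelevant 𝒜 I)

end Quotient

section Forms
variable {R : Type u} [CommRing R] {n : ℕ}

/-- The contraction `i_R ω = ∑ x_i ω_i` of the polynomial `1`-form `ω = ∑ ω_i dx_i` with the radial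
vector field. A polynomial `1`-form is given by its family of coefficients `ω_i`. -/
def contractRadial (ω : Fin (n + 1) → MvPolynomial (Fin (n + 1)) R) :
    MvPolynomial (Fin (n + 1)) R :=
  ∑ i, MvPolynomial.X i * ω i

/-- The coefficient of `dx_i ∧ dx_j` in the exterior derivative `dω`. -/
def extDeriv (ω : Fin (n + 1) → MvPolynomial (Fin (n + 1)) R) (i j : Fin (n + 1)) :
    MvPolynomial (Fin (n + 1)) R :=
  MvPolynomial.pderiv i (ω j) - MvPolynomial.pderiv j (ω i)

/-- The coefficient of `dx_i ∧ dx_j ∧ dx_l` in `ω ∧ dω`. -/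
def wedgeExtDeriv (ω : Fin (n + 1) → MvPolynomial (Fin (n + 1)) R) (i j l : Fin (n + 1)) :
    MvPolynomial (Fin (n + 1)) R :=
  ω i * extDeriv ω j l - ω j * extDeriv ω i l + ω l * extDeriv ω i j

/-- The singular ideal of a polynomial `1`-form, generated by its coefficients. -/
def singIdeal (ω : Fin (n + 1) → MvPolynomial (Fin (n + 1)) R) :
    Ideal (MvPolynomial (Fin (n + 1)) R) :=
  Ideal.span (Set.range ω)

end Forms

section Sat
open MvPolynomial
variable {K : Type u} [Field K] {n d : ℕ}

/-- For a homogeneous `1`-form over a field, the zero locus has codimension at least two if and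
only if no nonzero `1`-form of smaller degree is proportional to it. -/
theorem two_le_height_iff (ω : Fin (n + 1) → MvPolynomial (Fin (n + 1)) K)
    (hω : ∀ i, (ω i).IsHomogeneous (d + 1)) :
    2 ≤ (singIdeal ω).height ↔ ∀ b : Fin (n + 1) → MvPolynomial (Fin (n + 1)) K,
      (∀ i, (b i).totalDegree ≤ d) → (∀ i j, ω i * b j = ω j * b i) → b = 0 := by
  constructor
  · intro h b hb hp
    by_contra hne
    obtain ⟨j, hj⟩ : ∃ j, b j ≠ 0 := by
      by_contra! hc
      exact hne (funext hc)
    have hωj : ω j ≠ 0 := by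
      intro h0
      have hz : ∀ i, ω i = 0 := fun i => by
        have := hp i j
        rw [h0, zero_mul] at this
        exact (mul_eq_zero.1 this).resolve_right hj
      have : singIdeal ω = ⊥ := by
        rw [singIdeal, Ideal.span_eq_bot]
        rintro _ ⟨i, rfl⟩
        exact hz i
      rw [this, Ideal.height_bot] at h
      simp at h
    obtain ⟨u, v, g, huv, hu, hv⟩ :=
      UniqueFactorizationMonoid.exists_reduced_factors (ω j) hωj (b j)
    have hg : g ≠ 0 := by
      rintro rfl
      exact hωj (by rw [← hu, zero_mul])
    have hunit : ¬ IsUnit u := by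
      intro hun
      have hdvd : ω j ∣ b j := by
        rw [← hu, ← hv]
        exact mul_dvd_mul_left _ hun.dvd
      obtain ⟨c, hc⟩ := hdvd
      have hc0 : c ≠ 0 := by
        rintro rfl
        exact hj (by rw [hc, mul_zero])
      have h1 := hb j
      rw [hc, totalDegree_mul_of_isDomain hωj hc0, (hω j).totalDegree hωj] at h1
      omega
    have hdv : ∀ i, u ∣ ω i := by
      intro i
      have := hp i j
      rw [← hu, ← hv] at this
      have h2 : ω i * v = u * b i := by
        apply mul_left_cancel₀ hg
        linear_combination this
      exact huv.dvd_of_dvd_mul_right (Dvd.intro _ h2.symm)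
    have hle : singIdeal ω ≤ Ideal.span {u} := by
      rw [singIdeal, Ideal.span_le]
      rintro _ ⟨i, rfl⟩
      exact Ideal.mem_span_singleton.2 (hdv i)
    have := (h.trans (Ideal.height_mono hle)).trans (Ideal.height_span_singleton_le_one hunit)
    exact absurd this (by decide)
  · intro h
    by_contra hlt
    rw [not_le] at hlt
    have hω0 : ∃ j, ω j ≠ 0 := by
      by_contra! hc
      have := h (fun _ => 1) (fun _ => by simp) (fun i j => by rw [hc, hc])
      exact one_ne_zero (congrFun this 0)
    obtain ⟨j, hj⟩ := hω0
    have hfin : (singIdeal ω).height ≠ ⊤ := (hlt.trans_le le_top).ne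
    obtain ⟨m, hm⟩ := ENat.ne_top_iff_exists.1 hfin
    obtain ⟨P, hP, hle, hPm⟩ := Ideal.exists_isPrime_height_eq hm.symm
    have hjP : ω j ∈ P := hle (Ideal.subset_span ⟨j, rfl⟩)
    have hPbot : P ≠ ⊥ := by
      rintro rfl
      exact hj hjP
    obtain ⟨q, hqP, hq⟩ := Ideal.IsPrime.exists_mem_prime_of_ne_bot hP hPbot
    have hP1 : P.height = 1 := by
      have h0 : P.height ≠ 0 := fun h0 => hPbot (Ideal.height_eq_zero_iff_eq_bot.1 h0)
      rw [← hm] at hlt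
      rw [hPm] at h0 ⊢
      norm_cast at hlt h0 ⊢
      omega
    have hPq := Ideal.eq_span_singleton_of_height_eq_one hP1 hqP hq
    have hdvd : ∀ i, q ∣ ω i := fun i =>
      Ideal.mem_span_singleton.1 (hPq ▸ hle (Ideal.subset_span ⟨i, rfl⟩))
    choose c hc using hdvd
    have hq1 : 1 ≤ q.totalDegree := by
      by_contra! hlt1
      have h0 := totalDegree_eq_zero_iff_eq_C.1 (Nat.lt_one_iff.1 hlt1)
      apply hq.not_isUnit
      rw [h0]
      refine (IsUnit.mk0 _ fun hz => hq.ne_zero ?_).map C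
      rw [h0, hz, C_0]
    have := h c (fun i => by
      by_cases hci : c i = 0
      · simp [hci]
      · have h1 := (hω i).totalDegree_le
        rw [hc i, totalDegree_mul_of_isDomain hq.ne_zero hci] at h1
        omega) (fun i j => by rw [hc i, hc j]; ring)
    exact hj (by rw [hc j, this, Pi.zero_apply, mul_zero])

end Sat

section Minors
variable {K : Type u} [Field K] {ι τ : Type*} [Fintype τ] [DecidableEq τ]

theorem exists_minor_ne_zero (M : Matrix ι τ K) :
    (∀ β : τ → K, M.mulVec β = 0 → β = 0) ↔ ∃ f : τ → ι, (M.submatrix f id).det ≠ 0 := by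
  constructor
  · intro h
    have hspan : Submodule.span K (Set.range M) = ⊤ := by
      by_contra hne
      obtain ⟨g, hg, hgl⟩ := Submodule.exists_le_ker_of_lt_top _ (lt_top_iff_ne_top.2 hne)
      apply hg
      have hβ := h (fun t => g fun j => if t = j then 1 else 0) (by
        ext r
        have : g (M r) = 0 := hgl (Submodule.subset_span ⟨r, rfl⟩)
        rw [LinearMap.pi_apply_eq_sum_univ] at this
        exact this)
      ext v
      rw [LinearMap.comp_apply, LinearMap.pi_apply_eq_sum_univ]
      exact Finset.sum_eq_zero fun t _ => by rw [congrFun hβ t]; simp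
    obtain ⟨b, hb, hbs, hli⟩ := exists_linearIndependent K (Set.range M)
    rw [hspan] at hbs
    let B : Module.Basis b K (τ → K) := Module.Basis.mk hli (by simp [hbs])
    let e : τ ≃ b := (Pi.basisFun K τ).indexEquiv B
    choose f hf using fun t => hb (e t).2
    refine ⟨f, ?_⟩
    have hrow : LinearIndependent K (M.submatrix f id).row := by
      have : (M.submatrix f id).row = fun t => ((e t : b) : τ → K) := by
        funext t
        exact hf t
      rw [this]
      exact hli.comp e e.injective
    exact ((Matrix.isUnit_iff_isUnit_det _).1
      (Matrix.linearIndependent_rows_iff_isUnit.1 hrow)).ne_zero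
  · rintro ⟨f, hf⟩ β hβ
    refine Matrix.eq_zero_of_mulVec_eq_zero hf ?_
    ext t
    exact congrFun hβ (f t)

end Minors

section Space
open MvPolynomial
variable (k : Type u) [Field k] (n d : ℕ)

/-- The ring of polynomial functions on the vector space of homogeneous polynomial `1`-forms on
`𝔸^{n+1}` with coefficients of degree `d + 1`: it has one variable for each `i ∈ {0, …, n}` and
each monomial of degree `d + 1`, namely the coefficient of this monomial in `ω_i`. -/
abbrev CoeffRing : Type u := MvPolynomial (Fin (n + 1) × Sym (Fin (n + 1)) (d + 1)) k

/-- The standard grading of `CoeffRing`. -/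
abbrev coeffGrading : ℕ → Submodule k (CoeffRing k n d) :=
  homogeneousSubmodule (Fin (n + 1) × Sym (Fin (n + 1)) (d + 1)) k

instance coeffGrading_gradedAlgebra : GradedAlgebra (coeffGrading k n d) :=
  MvPolynomial.gradedAlgebra

/-- The universal homogeneous polynomial `1`-form with coefficients of degree `d + 1`. -/
def univForm (i : Fin (n + 1)) : MvPolynomial (Fin (n + 1)) (CoeffRing k n d) :=
  ∑ s : Sym (Fin (n + 1)) (d + 1),
    monomial (Multiset.toFinsupp (s : Multiset (Fin (n + 1)))) (X (i, s))

/-- The projective space of lines in the vector space of homogeneous polynomial `1`-forms on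
`𝔸^{n+1}` with coefficients of degree `d + 1`. -/
abbrev formSpace : Scheme.{u} := Proj (coeffGrading k n d)

variable {k n d}

/-- The homogeneous prime ideal of `CoeffRing` corresponding to a point of `formSpace`. -/
def pointIdeal (x : formSpace k n d) : Ideal (CoeffRing k n d) :=
  (ProjectiveSpectrum.asHomogeneousIdeal (𝒜 := coeffGrading k n d) x).toIdeal

instance pointIdeal_isPrime (x : formSpace k n d) : (pointIdeal x).IsPrime :=
  ProjectiveSpectrum.isPrime (𝒜 := coeffGrading k n d) x

/-- The `1`-form parametrized by a point of `formSpace`. Its coefficients lie in the fraction field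
of the homogeneous coordinate ring of the closure of the point, which is a purely transcendental
extension of the residue field of the point. -/
def formAt (x : formSpace k n d) (i : Fin (n + 1)) :
    MvPolynomial (Fin (n + 1)) (pointIdeal x).ResidueField :=
  map (algebraMap (CoeffRing k n d) (pointIdeal x).ResidueField) (univForm k n d i)

theorem formAt_isHomogeneous (x : formSpace k n d) (i : Fin (n + 1)) :
    (formAt x i).IsHomogeneous (d + 1) := by
  refine IsHomogeneous.map (IsHomogeneous.sum _ _ _ fun s _ => isHomogeneous_monomial _ ?_) _
  have h := Multiset.toFinsupp_sum_eq (s : Multiset (Fin (n + 1)))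
  rw [Finsupp.sum_fintype _ _ (fun _ => rfl)] at h
  rw [Finsupp.degree_eq_sum]
  exact h.trans s.2

/-- The set of points of `formSpace` whose `1`-form has singular set of codimension at least two.
The codimension of the singular set is the height of the ideal of the coefficients of the form. -/
def saturatedSet (k : Type u) [Field k] (n d : ℕ) : Set (formSpace k n d) :=
  {x | 2 ≤ (singIdeal (formAt x)).height}

/-- The exponents of the monomials of degree at most `d`. -/
abbrev LowExp (n d : ℕ) : Type := {s : Fin (n + 1) →₀ ℕ // s.degree ≤ d}

instance lowExp_finite (n d : ℕ) : Finite (LowExp n d) := Finsupp.finite_of_degree_le d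

/-- The matrix, over the coordinate ring of the space of `1`-forms `ω`, of the linear map that sends
a `1`-form `b` with coefficients of degree at most `d` to `ω ∧ b`. -/
def wedgeMatrix (k : Type u) [Field k] (n d : ℕ) :
    Matrix (Fin (n + 1) × Fin (n + 1) × (Fin (n + 1) →₀ ℕ)) (Fin (n + 1) × LowExp n d)
      (CoeffRing k n d) := fun r t =>
  coeff r.2.2 ((if t.1 = r.2.1 then univForm k n d r.1 * monomial t.2.1 1 else 0) -
    (if t.1 = r.1 then univForm k n d r.2.1 * monomial t.2.1 1 else 0))

theorem wedgeMatrix_mulVec [Fintype (LowExp n d)] (x : formSpace k n d)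
    (β : Fin (n + 1) × LowExp n d → (pointIdeal x).ResidueField)
    (r : Fin (n + 1) × Fin (n + 1) × (Fin (n + 1) →₀ ℕ)) :
    ((wedgeMatrix k n d).map (algebraMap _ (pointIdeal x).ResidueField)).mulVec β r =
      coeff r.2.2 (formAt x r.1 * (∑ s, monomial s.1 (β (r.2.1, s))) -
        formAt x r.2.1 * (∑ s, monomial s.1 (β (r.1, s)))) := by
  obtain ⟨i, j, c⟩ := r
  have key : ∀ t : Fin (n + 1) × LowExp n d,
      algebraMap _ (pointIdeal x).ResidueField (wedgeMatrix k n d (i, j, c) t) * β t =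
      coeff c ((if t.1 = j then formAt x i * monomial t.2.1 (β t) else 0) -
        (if t.1 = i then formAt x j * monomial t.2.1 (β t) else 0)) := by
    intro t
    have hm : (monomial t.2.1 (β t) : MvPolynomial (Fin (n + 1)) (pointIdeal x).ResidueField) =
        C (β t) * monomial t.2.1 1 := by rw [C_mul_monomial, mul_one]
    rw [wedgeMatrix, ← coeff_map, mul_comm, ← coeff_C_mul, map_sub, hm]
    congr 1
    split_ifs <;> simp [formAt] <;> ring
  change ∑ t, algebraMap _ (pointIdeal x).ResidueField (wedgeMatrix k n d (i, j, c) t) * β t = _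
  simp_rw [key]
  rw [← coeff_sum, Finset.sum_sub_distrib, Fintype.sum_prod_type, Fintype.sum_prod_type]
  congr 2
  · rw [Finset.sum_eq_single j]
    · simp [Finset.mul_sum]
    · intro l _ hl
      simp [hl]
    · simp
  · rw [Finset.sum_eq_single i]
    · simp [Finset.mul_sum]
    · intro l _ hl
      simp [hl]
    · simp

theorem eq_sum_lowExp {K : Type u} [Field K] [Fintype (LowExp n d)]
    (b : MvPolynomial (Fin (n + 1)) K) (hb : b.totalDegree ≤ d) :
    b = ∑ s : LowExp n d, monomial s.1 (coeff s.1 b) := by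
  classical
  ext c
  rw [coeff_sum]
  simp_rw [coeff_monomial]
  by_cases hc : c.degree ≤ d
  · rw [Finset.sum_eq_single ⟨c, hc⟩]
    · simp
    · intro s _ hs
      rw [if_neg]
      exact fun h => hs (Subtype.ext h)
    · simp
  · rw [Finset.sum_eq_zero]
    · by_contra h
      have := le_totalDegree (mem_support_iff.2 h)
      rw [Finsupp.degree_apply] at hc
      exact hc (this.trans hb)
    · intro s _
      rw [if_neg]
      rintro rfl
      exact hc s.2

theorem mem_saturatedSet_iff [Fintype (LowExp n d)] (x : formSpace k n d) :
    x ∈ saturatedSet k n d ↔ ∃ f : Fin (n + 1) × LowExp n d →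
      Fin (n + 1) × Fin (n + 1) × (Fin (n + 1) →₀ ℕ),
      ((wedgeMatrix k n d).submatrix f id).det ∉ pointIdeal x := by
  have h1 : x ∈ saturatedSet k n d ↔ _ := two_le_height_iff (formAt x) (formAt_isHomogeneous x)
  have h2 : ∀ f : Fin (n + 1) × LowExp n d → Fin (n + 1) × Fin (n + 1) × (Fin (n + 1) →₀ ℕ),
      ((wedgeMatrix k n d).submatrix f id).det ∉ pointIdeal x ↔
      (((wedgeMatrix k n d).map (algebraMap _ (pointIdeal x).ResidueField)).submatrix f id).det ≠
        0 := by
    intro f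
    rw [← Ideal.algebraMap_residueField_eq_zero.not, RingHom.map_det]
    rfl
  simp_rw [h2]
  rw [← exists_minor_ne_zero, h1]
  constructor
  · intro h β hβ
    have hb := h (fun l => ∑ s : LowExp n d, monomial s.1 (β (l, s))) (fun l => by
      refine totalDegree_finsetSum_le fun s _ => (totalDegree_monomial_le _ _).trans ?_
      exact s.2) (fun i j => by
        ext c
        have := congrFun hβ (i, j, c)
        rw [wedgeMatrix_mulVec, coeff_sub] at this
        exact sub_eq_zero.1 this)
    classical
    ext ⟨l, s⟩
    have := congrArg (coeff s.1) (congrFun hb l)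
    rw [coeff_sum] at this
    simp_rw [coeff_monomial] at this
    rw [Finset.sum_eq_single s] at this
    · simpa using this
    · intro s' _ hs
      rw [if_neg]
      exact fun h => hs (Subtype.ext h)
    · simp
  · intro h b hb hp
    have hβ := h (fun t => coeff t.2.1 (b t.1)) (by
      ext ⟨i, j, c⟩
      rw [wedgeMatrix_mulVec]
      simp only
      rw [← eq_sum_lowExp _ (hb i), ← eq_sum_lowExp _ (hb j), hp i j, sub_self]
      rfl)
    funext l
    rw [eq_sum_lowExp _ (hb l)]
    refine Finset.sum_eq_zero fun s _ => ?_
    have := congrFun hβ (l, s)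
    simp only at this
    rw [this]
    simp

theorem isOpen_saturatedSet : IsOpen (saturatedSet k n d) := by
  have := Fintype.ofFinite (LowExp n d)
  have : saturatedSet k n d = ⋃ f : Fin (n + 1) × LowExp n d →
      Fin (n + 1) × Fin (n + 1) × (Fin (n + 1) →₀ ℕ),
      (Proj.basicOpen (coeffGrading k n d) ((wedgeMatrix k n d).submatrix f id).det :
        Set (Proj (coeffGrading k n d))) := by
    ext x
    rw [mem_saturatedSet_iff, Set.mem_iUnion]
    rfl
  rw [this]
  exact isOpen_iUnion fun f => (Proj.basicOpen (coeffGrading k n d) _).isOpen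

/-- The open subscheme of `formSpace` where the singular set has codimension at least two. -/
def saturatedLocus (k : Type u) [Field k] (n d : ℕ) : (formSpace k n d).Opens :=
  ⟨saturatedSet k n d, isOpen_saturatedSet⟩

section Equations

/-- The polynomial `P` over `CoeffRing` has homogeneous coefficients of degree `m`. -/
def CoeffHomog (m : ℕ) (P : MvPolynomial (Fin (n + 1)) (CoeffRing k n d)) : Prop :=
  ∀ c, (coeff c P).IsHomogeneous m

theorem CoeffHomog.sub {m : ℕ} {P Q : MvPolynomial (Fin (n + 1)) (CoeffRing k n d)}
    (hP : CoeffHomog m P) (hQ : CoeffHomog m Q) : CoeffHomog m (P - Q) := fun c => by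
  rw [coeff_sub]
  exact (hP c).sub (hQ c)

theorem CoeffHomog.add {m : ℕ} {P Q : MvPolynomial (Fin (n + 1)) (CoeffRing k n d)}
    (hP : CoeffHomog m P) (hQ : CoeffHomog m Q) : CoeffHomog m (P + Q) := fun c => by
  rw [coeff_add]
  exact (hP c).add (hQ c)

theorem CoeffHomog.mul {m m' : ℕ} {P Q : MvPolynomial (Fin (n + 1)) (CoeffRing k n d)}
    (hP : CoeffHomog m P) (hQ : CoeffHomog m' Q) : CoeffHomog (m + m') (P * Q) := fun c => by
  classical
  rw [coeff_mul]
  exact IsHomogeneous.sum _ _ _ fun x _ => (hP x.1).mul (hQ x.2)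

theorem coeffHomog_univForm (i : Fin (n + 1)) : CoeffHomog 1 (univForm k n d i) := fun c => by
  classical
  rw [univForm, coeff_sum]
  refine IsHomogeneous.sum _ _ _ fun s _ => ?_
  rw [coeff_monomial]
  split_ifs
  · exact isHomogeneous_X _ _
  · exact isHomogeneous_zero _ _ _

theorem coeffHomog_contractRadial : CoeffHomog 1 (contractRadial (univForm k n d)) := fun c => by
  classical
  rw [contractRadial, coeff_sum]
  refine IsHomogeneous.sum _ _ _ fun i _ => ?_
  rw [coeff_X_mul']
  split_ifs
  · exact coeffHomog_univForm i _
  · exact isHomogeneous_zero _ _ _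

theorem CoeffHomog.pderiv {m : ℕ} {P : MvPolynomial (Fin (n + 1)) (CoeffRing k n d)}
    (hP : CoeffHomog m P) (i : Fin (n + 1)) : CoeffHomog m (MvPolynomial.pderiv i P) := fun c => by
  rw [coeff_pderiv]
  have : ((c i : CoeffRing k n d) + 1) = C ((c i : k) + 1) := by simp
  rw [this, mul_comm]
  exact (hP _).C_mul _

theorem coeffHomog_extDeriv (i j : Fin (n + 1)) : CoeffHomog 1 (extDeriv (univForm k n d) i j) :=
  ((coeffHomog_univForm j).pderiv i).sub ((coeffHomog_univForm i).pderiv j)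

theorem coeffHomog_wedgeExtDeriv (i j l : Fin (n + 1)) :
    CoeffHomog 2 (wedgeExtDeriv (univForm k n d) i j l) :=
  (((coeffHomog_univForm i).mul (coeffHomog_extDeriv j l)).sub
    ((coeffHomog_univForm j).mul (coeffHomog_extDeriv i l))).add
    ((coeffHomog_univForm l).mul (coeffHomog_extDeriv i j))

variable (k n d)

/-- The linear equations `i_R ω = 0` of the space of projective `1`-forms of degree `d + 2`. -/
def radialEquations : Set (CoeffRing k n d) :=
  {a | ∃ c, a = coeff c (contractRadial (univForm k n d))}

/-- The quadratic equations `ω ∧ dω = 0`. -/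
def integrabilityEquations : Set (CoeffRing k n d) :=
  {a | ∃ i j l c, a = coeff c (wedgeExtDeriv (univForm k n d) i j l)}

/-- The linear equations `dω = 0`. -/
def closedEquations : Set (CoeffRing k n d) :=
  {a | ∃ i j c, a = coeff c (extDeriv (univForm k n d) i j)}

/-- The homogeneous ideal defining integrable projective `1`-forms of degree `d + 2`. -/
def integrableIdeal : HomogeneousIdeal (coeffGrading k n d) :=
  ⟨Ideal.span (radialEquations k n d ∪ integrabilityEquations k n d), by
    refine Ideal.homogeneous_span _ _ ?_
    rintro _ (⟨c, rfl⟩ | ⟨i, j, l, c, rfl⟩)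
    · exact ⟨1, coeffHomog_contractRadial c⟩
    · exact ⟨2, coeffHomog_wedgeExtDeriv i j l c⟩⟩

/-- The homogeneous ideal defining closed projective `1`-forms of degree `d + 2`. -/
def closedIdeal : HomogeneousIdeal (coeffGrading k n d) :=
  ⟨Ideal.span (radialEquations k n d ∪ closedEquations k n d), by
    refine Ideal.homogeneous_span _ _ ?_
    rintro _ (⟨c, rfl⟩ | ⟨i, j, c, rfl⟩)
    · exact ⟨1, coeffHomog_contractRadial c⟩
    · exact ⟨1, coeffHomog_extDeriv i j c⟩⟩

end Equations

variable (k n d)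

/-- The scheme `Fol_d(ℙⁿ)` of codimension one foliations of degree `d` on `ℙⁿ`: the locally closed
subscheme of `formSpace` (contained in the linear subspace of projective `1`-forms of degree
`d + 2`) defined by the equations `i_R ω = 0` and `ω ∧ dω = 0` and by the open condition
`codim sing(ω) ≥ 2`. -/
abbrev Fol : Scheme.{u} :=
  (closedSubι (coeffGrading k n d) (integrableIdeal k n d) ⁻¹ᵁ saturatedLocus k n d).toScheme

/-- The immersion of `Fol_d(ℙⁿ)` into the projective space of `1`-forms. -/
def Folι : Fol k n d ⟶ formSpace k n d :=
  (closedSubι (coeffGrading k n d) (integrableIdeal k n d) ⁻¹ᵁ saturatedLocus k n d).ι ≫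
    closedSubι (coeffGrading k n d) (integrableIdeal k n d)

/-- The projectivization of the vector space of closed projective `1`-forms of degree `d + 2`. -/
abbrev closedFormSpace : Scheme.{u} := closedSub (coeffGrading k n d) (closedIdeal k n d)

/-- The immersion of the projectivization of the space of closed projective `1`-forms into the
projective space of `1`-forms. -/
def closedFormSpaceι : closedFormSpace k n d ⟶ formSpace k n d :=
  closedSubι (coeffGrading k n d) (closedIdeal k n d)

/-- The subset of `Fol_d(ℙⁿ)` of the foliations defined by closed projective `1`-forms. -/
def closedFoliations : Set (Fol k n d) :=
  Folι k n d ⁻¹' Set.range (closedFormSpaceι k n d)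

end Space

end
end Foliation

/-! Wedging with a sufficiently general closed form is injective on 2-forms of degree at most `d`,
so near such a form the equation `ω ∧ dω = 0` already forces `dω = 0`, scheme-theoretically.

The general closed form is `ω = df` with `f = x₀^m x₁ + x₁^m x₂ + x₂^m x₃` and `m = d + 1`. Since
`deg f = pe` vanishes in the field, Euler's formula makes `df` projective. The leading powers of
three of its coefficients involve different variables and have degree `d + 1`, whereas `dω` has
degree `d`; comparing degrees one variable at a time shows that `ω ∧ θ = 0` implies `θ = 0`
(`IsTriangular.eq_zero_of_wedgeTwo`).

Hence the matrix of `θ ↦ ω ∧ θ` for the universal form has a maximal minor `δ` which is nonzero at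
`df`. Cramer's rule applied to `θ = dω` gives `δ • closedIdeal ≤ integrableIdeal`
(`exists_mul_mem_integrableIdeal`), so the two ideals coincide where `δ` is invertible.

The ideal of closed forms is generated by linear forms, hence prime. The same degree argument for
1-forms shows that `df` has singular set of codimension at least two, so the prime is a point `ξ` of
`Fol`. The closed foliations are the closure of `ξ`, contain the open set `δ ≠ 0`, and `Fol` is
reduced on that set. -/

namespace Foliation
noncomputable section

/-! ### Ideals generated by linear forms. -/

section LinearForms
open MvPolynomial

/-- An ideal generated by linear forms is prime. -/
theorem isPrime_span_of_isHomogeneous_one {σ : Type*} {K : Type*} [Field K]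
    {S : Set (MvPolynomial σ K)} (hS : ∀ a ∈ S, a.IsHomogeneous 1) : (Ideal.span S).IsPrime := by
  -- The complement is taken in the whole polynomial ring, so `π (X i)` need not be linear. It
  -- suffices that `π` kills `S` and moves each element by an element of the span of `S`: the
  -- substitution `X i ↦ π (X i)` then has kernel exactly `Ideal.span S`, and its target is a
  -- domain.
  obtain ⟨C, hC⟩ := Submodule.exists_isCompl (Submodule.span K S)
  let π : MvPolynomial σ K →ₗ[K] MvPolynomial σ K := C.subtype ∘ₗ C.projectionOnto _ hC.symm
  have hπ : ∀ a, a - π a ∈ Ideal.span S := fun a => by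
    have h : a - π a ∈ Submodule.span K S := by
      rw [← Submodule.ker_projectionOnto hC.symm]
      rw [LinearMap.mem_ker, map_sub, sub_eq_zero]
      exact (Submodule.projectionOnto_apply_left hC.symm _).symm
    exact Submodule.span_le_restrictScalars K (MvPolynomial σ K) S h
  let Φ : MvPolynomial σ K →ₐ[K] MvPolynomial σ K := aeval fun i => π (X i)
  have hΦ : ∀ a, a - Φ a ∈ Ideal.span S := fun a => by
    rw [← Ideal.Quotient.mk_eq_mk_iff_sub_mem]
    have : (Ideal.Quotient.mkₐ K (Ideal.span S)) = (Ideal.Quotient.mkₐ K (Ideal.span S)).comp Φ := by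
      refine algHom_ext fun i => ?_
      rw [AlgHom.comp_apply, aeval_X]
      exact (Ideal.Quotient.mk_eq_mk_iff_sub_mem _ _).2 (hπ _)
    exact DFunLike.congr_fun this a
  have hlin : ∀ a : MvPolynomial σ K, a.IsHomogeneous 1 → Φ a = π a := fun a ha => by
    rw [← mem_homogeneousSubmodule, homogeneousSubmodule_one_eq_span_X] at ha
    induction ha using Submodule.span_induction with
    | mem x h => obtain ⟨i, rfl⟩ := h; simp [Φ]
    | zero => simp
    | add x y _ _ hx hy => rw [map_add, map_add, hx, hy]
    | smul c x _ hx => rw [map_smul, map_smul, hx]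
  have : Ideal.span S = RingHom.ker Φ := by
    refine le_antisymm (Ideal.span_le.2 fun a ha => ?_) fun a ha => ?_
    · rw [SetLike.mem_coe, RingHom.mem_ker, hlin a (hS a ha)]
      have : a ∈ LinearMap.ker (C.projectionOnto _ hC.symm) := by
        rw [Submodule.ker_projectionOnto]
        exact Submodule.subset_span ha
      simp [π, LinearMap.mem_ker.1 this]
    · have := hΦ a
      rwa [RingHom.mem_ker.1 ha, sub_zero] at this
  rw [this]
  exact RingHom.ker_isPrime _

end LinearForms

/-! ### Cramer's rule modulo an ideal. -/

section Minors

/-- If a matrix becomes injective after specialization, then some minor with nonzero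
specialization annihilates, modulo any ideal, the vectors which the matrix sends into the ideal. -/
theorem exists_mul_mem_of_mulVec_mem {A K ι τ : Type*} [CommRing A] [Field K] [Fintype τ]
    (φ : A →+* K) (M : Matrix ι τ A) (hM : ∀ β : τ → K, (M.map φ).mulVec β = 0 → β = 0) :
    ∃ δ, φ δ ≠ 0 ∧ ∀ (J : Ideal A) (v : τ → A), (∀ r, M.mulVec v r ∈ J) → ∀ t, δ * v t ∈ J := by
  classical
  obtain ⟨f, hf⟩ := (exists_minor_ne_zero (M.map φ)).1 hM
  refine ⟨(M.submatrix f id).det, ?_, fun J v hv t => ?_⟩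
  · rw [RingHom.map_det]
    exact hf
  -- The adjugate of the chosen square submatrix turns `δ * v t` into a combination of entries of `M
  -- v`.
  · have h := congrFun (congrArg (fun N => N.mulVec v) (Matrix.adjugate_mul (M.submatrix f id))) t
    simp only [Matrix.smul_mulVec, Matrix.one_mulVec, Pi.smul_apply, smul_eq_mul] at h
    rw [← h, ← Matrix.mulVec_mulVec]
    exact Ideal.sum_mem _ fun s _ => Ideal.mul_mem_left _ _ (hv (f s))

end Minors

/-! ### Degree comparison in a single variable. -/

section Degree
open MvPolynomial
variable {R : Type*} [CommRing R] {σ : Type*}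

/-- Degrees in one variable add over a domain, so a nonzero `P` would force the product to have
degree at least `m` in that variable. -/
theorem eq_zero_of_degreeOf_lt [IsDomain R] {m : ℕ} {a : σ} {p P q : MvPolynomial σ R}
    (hp : m ≤ p.degreeOf a) (hq : q.degreeOf a < m) (h : p * P = q) : P = 0 := by
  by_contra hP
  have hp0 : p ≠ 0 := by
    rintro rfl
    simp at hp
    omega
  have := degreeOf_mul_eq (n := a) hp0 hP
  rw [h] at this
  omega

theorem degreeOf_mul_lt {m : ℕ} {a : σ} {p P : MvPolynomial σ R}
    (hp : p.degreeOf a = 0) (hP : P.totalDegree < m) : (p * P).degreeOf a < m := by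
  have h1 := degreeOf_mul_le a p P
  have h2 := degreeOf_le_totalDegree P a
  omega

end Degree

/-! ### Wedge product with a matrix of polynomials, in coordinates. -/

section TwoForms
open MvPolynomial
variable {R : Type u} [CommRing R] {n : ℕ}

/-- The coefficients of the product of a polynomial `1`-form with a matrix of polynomials; for an
alternating matrix this is the wedge product with a `2`-form. -/
def wedgeTwo (ω : Fin (n + 1) → MvPolynomial (Fin (n + 1)) R)
    (θ : Fin (n + 1) → Fin (n + 1) → MvPolynomial (Fin (n + 1)) R) (i j l : Fin (n + 1)) :
    MvPolynomial (Fin (n + 1)) R :=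
  ω i * θ j l - ω j * θ i l + ω l * θ i j

/-- Needed over `CoeffRing`, the coefficient ring of the universal form, which is not a field. -/
theorem eq_sum_lowExp_of_commRing {d : ℕ} [Fintype (LowExp n d)]
    (b : MvPolynomial (Fin (n + 1)) R) (hb : b.totalDegree ≤ d) :
    b = ∑ s : LowExp n d, monomial s.1 (coeff s.1 b) := by
  classical
  ext c
  simp_rw [coeff_sum, coeff_monomial]
  by_cases hc : c.degree ≤ d
  · rw [Finset.sum_eq_single ⟨c, hc⟩ (fun s _ hs => if_neg fun h => hs (Subtype.ext h)) (by simp)]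
    simp
  · rw [Finset.sum_eq_zero fun s _ => if_neg (by rintro rfl; exact hc s.2)]
    by_contra h
    have := le_totalDegree (mem_support_iff.2 h)
    rw [Finsupp.degree_apply] at hc
    exact hc (this.trans hb)

theorem coeff_sum_lowExp {d : ℕ} [Fintype (LowExp n d)] (β : LowExp n d → R) (s : LowExp n d) :
    coeff s.1 (∑ t : LowExp n d, monomial t.1 (β t)) = β s := by
  classical
  simp_rw [coeff_sum, coeff_monomial]
  rw [Finset.sum_eq_single s (fun t _ ht => if_neg fun h => ht (Subtype.ext h)) (by simp)]
  simp

theorem totalDegree_sum_lowExp_le {d : ℕ} [Fintype (LowExp n d)] (β : LowExp n d → R) :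
    (∑ t : LowExp n d, monomial t.1 (β t)).totalDegree ≤ d :=
  totalDegree_finsetSum_le fun s _ => (totalDegree_monomial_le _ _).trans s.2

/-- The matrix of the linear map that sends a matrix `θ` of polynomials of degree at most `d` to
`ω ∧ θ`. -/
def wedgeTwoMatrix (ω : Fin (n + 1) → MvPolynomial (Fin (n + 1)) R) (d : ℕ) :
    Matrix (Fin (n + 1) × Fin (n + 1) × Fin (n + 1) × (Fin (n + 1) →₀ ℕ))
      (Fin (n + 1) × Fin (n + 1) × LowExp n d) R := fun r t =>
  coeff r.2.2.2 (wedgeTwo ω (fun a b => if a = t.1 ∧ b = t.2.1 then monomial t.2.2.1 1 else 0)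
    r.1 r.2.1 r.2.2.1)

theorem wedgeTwoMatrix_map {S : Type u} [CommRing S] (φ : R →+* S)
    (ω : Fin (n + 1) → MvPolynomial (Fin (n + 1)) R) (d : ℕ) :
    (wedgeTwoMatrix ω d).map φ = wedgeTwoMatrix (fun i => map φ (ω i)) d := by
  ext r t
  simp only [Matrix.map_apply, wedgeTwoMatrix, wedgeTwo, ← coeff_map, map_add, map_sub, map_mul,
    apply_ite (map φ), map_monomial, map_one, map_zero]

theorem wedgeTwoMatrix_mulVec {d : ℕ} [Fintype (LowExp n d)]
    (ω : Fin (n + 1) → MvPolynomial (Fin (n + 1)) R)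
    (β : Fin (n + 1) × Fin (n + 1) × LowExp n d → R)
    (i j l : Fin (n + 1)) (c : Fin (n + 1) →₀ ℕ) :
    (wedgeTwoMatrix ω d).mulVec β (i, j, l, c) =
      coeff c (wedgeTwo ω (fun a b => ∑ s, monomial s.1 (β (a, b, s))) i j l) := by
  have key : ∀ a b : Fin (n + 1), ∑ s, monomial s.1 (β (a, b, s)) =
      ∑ t : Fin (n + 1) × Fin (n + 1) × LowExp n d,
        C (β t) * (if a = t.1 ∧ b = t.2.1 then monomial t.2.2.1 1 else 0) := by
    intro a b
    rw [Fintype.sum_prod_type, Finset.sum_eq_single a (fun x _ hx => by simp [hx.symm]) (by simp),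
      Fintype.sum_prod_type, Finset.sum_eq_single b (fun x _ hx => by simp [hx.symm]) (by simp)]
    simp [C_mul_monomial]
  simp only [wedgeTwo, key]
  simp only [Finset.mul_sum]
  rw [← Finset.sum_sub_distrib, ← Finset.sum_add_distrib, coeff_sum]
  refine Finset.sum_congr rfl fun t _ => ?_
  change coeff c (wedgeTwo _ _ _ _ _) * β t = _
  rw [mul_comm, ← coeff_C_mul]
  congr 1
  rw [wedgeTwo]
  ring

end TwoForms

/-! ### Injectivity of the wedge product with a triangular form. -/

section Triangular
open MvPolynomial

/-- The coefficients `ω_1`, `ω_2`, `ω_3` of a polynomial `1`-form have triangular leading terms: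
they have degree at least `m` in pairwise distinct variables. -/
structure IsTriangular {R : Type u} [CommRing R] {n : ℕ}
    (ω : Fin (n + 1) → MvPolynomial (Fin (n + 1)) R) (m : ℕ) (i₀ i₁ i₂ i₃ : Fin (n + 1)) : Prop where
  le_degreeOf_one : m ≤ (ω i₁).degreeOf i₀
  degreeOf_two : (ω i₂).degreeOf i₀ = 0
  degreeOf_three : (ω i₃).degreeOf i₀ = 0
  le_degreeOf_two : m ≤ (ω i₂).degreeOf i₁
  degreeOf_three' : (ω i₃).degreeOf i₁ = 0
  ne_zero : ω i₃ ≠ 0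

variable {R : Type u} [CommRing R] [IsDomain R] {n m : ℕ}
  {ω : Fin (n + 1) → MvPolynomial (Fin (n + 1)) R} {i₀ i₁ i₂ i₃ : Fin (n + 1)}

/-- In `ω i₁ * b i₂ = ω i₂ * b i₁` the right side has degree less than `m` in `x_{i₀}`, which forces
`b i₂ = 0`; then `ω i₂ * b j = 0` for every `j`. -/
theorem IsTriangular.eq_zero_of_wedge (h : IsTriangular ω m i₀ i₁ i₂ i₃)
    {b : Fin (n + 1) → MvPolynomial (Fin (n + 1)) R} (hb : ∀ i, (b i).totalDegree < m)
    (hw : ∀ i j, ω i * b j - ω j * b i = 0) : b = 0 := by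
  have h2 : b i₂ = 0 := eq_zero_of_degreeOf_lt h.le_degreeOf_one
    (degreeOf_mul_lt h.degreeOf_two (hb i₁)) (sub_eq_zero.1 (hw i₁ i₂))
  have hm : 0 < m := (Nat.zero_le _).trans_lt (hb i₂)
  funext j
  refine eq_zero_of_degreeOf_lt (q := 0) h.le_degreeOf_two (by simpa using hm) ?_
  have := hw i₂ j
  rwa [h2, mul_zero, sub_zero] at this

/-- The relation for `(i₁, i₂, i₃)` is solved by degree in `x_{i₀}`, then in `x_{i₁}`, and finally
by `ω i₃ ≠ 0`. No symmetry of `θ` is assumed, so the rows `i₂` and `i₁` are then cleared, and the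
relations `(i₁, j, l)` reduce to `ω i₁ * θ j l = 0`. -/
theorem IsTriangular.eq_zero_of_wedgeTwo (h : IsTriangular ω m i₀ i₁ i₂ i₃)
    {θ : Fin (n + 1) → Fin (n + 1) → MvPolynomial (Fin (n + 1)) R}
    (hθ : ∀ i j, (θ i j).totalDegree < m) (hw : ∀ i j l, wedgeTwo ω θ i j l = 0) : θ = 0 := by
  have hm : 0 < m := (Nat.zero_le _).trans_lt (hθ i₀ i₀)
  have hz : ∀ (a : Fin (n + 1)), (0 : MvPolynomial (Fin (n + 1)) R).degreeOf a < m := by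
    simpa using hm
  simp only [wedgeTwo] at hw
  have h23 : θ i₂ i₃ = 0 := eq_zero_of_degreeOf_lt (q := ω i₂ * θ i₁ i₃ - ω i₃ * θ i₁ i₂)
    h.le_degreeOf_one ((degreeOf_sub_le _ _ _).trans_lt
      (max_lt (degreeOf_mul_lt h.degreeOf_two (hθ _ _)) (degreeOf_mul_lt h.degreeOf_three (hθ _ _))))
    (by linear_combination hw i₁ i₂ i₃)
  have h13 : θ i₁ i₃ = 0 := eq_zero_of_degreeOf_lt (q := ω i₃ * θ i₁ i₂) h.le_degreeOf_two
    (degreeOf_mul_lt h.degreeOf_three' (hθ _ _))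
    (by linear_combination ω i₁ * h23 - hw i₁ i₂ i₃)
  have h12 : θ i₁ i₂ = 0 := by
    have : ω i₃ * θ i₁ i₂ = 0 := by linear_combination ω i₂ * h13 - ω i₁ * h23 + hw i₁ i₂ i₃
    exact (mul_eq_zero.1 this).resolve_left h.ne_zero
  have h2 : ∀ l, θ i₂ l = 0 := fun l => eq_zero_of_degreeOf_lt (q := ω i₂ * θ i₁ l)
    h.le_degreeOf_one (degreeOf_mul_lt h.degreeOf_two (hθ _ _))
    (by linear_combination hw i₁ i₂ l - ω l * h12)
  have h1 : ∀ l, θ i₁ l = 0 := fun l => eq_zero_of_degreeOf_lt h.le_degreeOf_two (hz i₁)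
    (by linear_combination ω i₁ * h2 l + ω l * h12 - hw i₁ i₂ l)
  funext j l
  exact eq_zero_of_degreeOf_lt h.le_degreeOf_one (hz i₀)
    (by linear_combination hw i₁ j l + ω j * h1 l - ω l * h1 j)

end Triangular

/-! ### An explicit closed projective form with triangular coefficients. -/

section Example
open MvPolynomial
variable {R : Type u} [CommRing R] {n : ℕ}

/-- The polynomial `x_0^m x_1 + x_1^m x_2 + x_2^m x_3`. -/
def chainPoly (R : Type u) [CommRing R] {n : ℕ} (m : ℕ) (i : Fin 4 → Fin (n + 1)) :
    MvPolynomial (Fin (n + 1)) R :=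
  X (i 0) ^ m * X (i 1) + X (i 1) ^ m * X (i 2) + X (i 2) ^ m * X (i 3)

theorem chainPoly_isHomogeneous (m : ℕ) (i : Fin 4 → Fin (n + 1)) :
    (chainPoly R m i).IsHomogeneous (m + 1) :=
  have h : ∀ a b : Fin (n + 1), (X a ^ m * X b : MvPolynomial _ R).IsHomogeneous (m + 1) :=
    fun a b => (isHomogeneous_X_pow a m).mul (isHomogeneous_X R b)
  ((h _ _).add (h _ _)).add (h _ _)

/-- By Euler's formula the contraction of `dP` is `m P`; this is where the characteristic enters. -/
theorem contractRadial_pderiv {P : MvPolynomial (Fin (n + 1)) R} {m : ℕ} (hP : P.IsHomogeneous m)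
    (hm : (m : R) = 0) : contractRadial (fun i => pderiv i P) = 0 := by
  rw [contractRadial, hP.sum_X_mul_pderiv, nsmul_eq_mul, ← map_natCast C, hm, C_0, zero_mul]

/-- The bracket of two partial derivatives is a derivation that kills every variable, hence zero. -/
theorem extDeriv_pderiv (P : MvPolynomial (Fin (n + 1)) R) (i j : Fin (n + 1)) :
    extDeriv (fun i => pderiv i P) i j = 0 := by
  have h0 : (⁅pderiv i, pderiv j⁆ :
      Derivation R (MvPolynomial (Fin (n + 1)) R) (MvPolynomial (Fin (n + 1)) R)) = 0 :=
    derivation_ext fun l => by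
      classical
      rw [Derivation.commutator_apply]
      simp [Pi.single_apply, apply_ite]
  have h := DFunLike.congr_fun h0 P
  rw [Derivation.commutator_apply] at h
  exact h

/-- The derivatives by the second, third and fourth variables have leading powers `x₀^m`, `x₁^m`,
`x₂^m` with coefficient 1, so the value of `m` in `R` is irrelevant. -/
theorem isTriangular_chainPoly [IsDomain R] {m : ℕ} (hm : 0 < m) {i : Fin 4 → Fin (n + 1)}
    (hi : Function.Injective i) :
    IsTriangular (fun j => pderiv j (chainPoly R m i)) m (i 0) (i 1) (i 2) (i 3) := by
  classical
  have hne : ∀ a b : Fin 4, a ≠ b → i a ≠ i b := fun a b h h' => h (hi h')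
  have h01 := hne 0 1 (by decide)
  have h02 := hne 0 2 (by decide)
  have h03 := hne 0 3 (by decide)
  have h12 := hne 1 2 (by decide)
  have h13 := hne 1 3 (by decide)
  have h23 := hne 2 3 (by decide)
  have d1 : pderiv (i 1) (chainPoly R m i) =
      X (i 0) ^ m + C (m : R) * X (i 1) ^ (m - 1) * X (i 2) := by
    simp [chainPoly, h01, h12.symm, h13.symm]
    ring
  have d2 : pderiv (i 2) (chainPoly R m i) =
      X (i 1) ^ m + C (m : R) * X (i 2) ^ (m - 1) * X (i 3) := by
    simp [chainPoly, h12, h02, h23.symm]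
    ring
  have d3 : pderiv (i 3) (chainPoly R m i) = X (i 2) ^ m := by
    simp [chainPoly, h03, h13, h23]
  have deg : ∀ a b c : Fin (n + 1), a ≠ b → a ≠ c →
      (C (m : R) * X b ^ (m - 1) * X c).degreeOf a = 0 := fun a b c hb hc => by
    rw [degreeOf_mul_X_of_ne _ hc, degreeOf_mul_X_pow_of_ne _ hb, degreeOf_C]
  have degp : ∀ a b : Fin (n + 1), a ≠ b → (X b ^ m : MvPolynomial _ R).degreeOf a = 0 :=
    fun a b hb => degreeOf_X_pow_of_ne m hb
  have lead : ∀ a b c : Fin (n + 1), a ≠ b → a ≠ c →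
      m ≤ (X a ^ m + C (m : R) * X b ^ (m - 1) * X c).degreeOf a := fun a b c hb hc => by
    rw [degreeOf_add_eq_of_degreeOf_lt, degreeOf_X_self_pow]
    rwa [deg a b c hb hc, degreeOf_X_self_pow]
  have hadd : ∀ (a : Fin (n + 1)) (P Q : MvPolynomial (Fin (n + 1)) R), P.degreeOf a = 0 →
      Q.degreeOf a = 0 → (P + Q).degreeOf a = 0 := fun a P Q hP hQ => by
    have := degreeOf_add_le a P Q
    omega
  exact {
    le_degreeOf_one := d1 ▸ lead _ _ _ h01 h02
    degreeOf_two := d2 ▸ hadd _ _ _ (degp _ _ h01) (deg _ _ _ h02 h03)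
    degreeOf_three := d3 ▸ degp _ _ h02
    le_degreeOf_two := d2 ▸ lead _ _ _ h12 h13
    degreeOf_three' := d3 ▸ degp _ _ h12
    ne_zero := d3 ▸ pow_ne_zero m (X_ne_zero _) }

end Example

/-! ### Evaluation of the universal form and comparison of the two ideals. -/

section Specialization
open MvPolynomial
variable {k : Type u} [Field k] {n d : ℕ}

/-- The evaluation of polynomial functions on the space of `1`-forms at a given `1`-form. -/
def evalAt (d : ℕ) (ω : Fin (n + 1) → MvPolynomial (Fin (n + 1)) k) : CoeffRing k n d →+* k :=
  eval fun t => coeff (Multiset.toFinsupp (t.2 : Multiset (Fin (n + 1)))) (ω t.1)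

/-- Homogeneity is essential: `evalAt` records only the coefficients of monomials of degree `d + 1`.
-/
theorem map_evalAt_univForm {ω : Fin (n + 1) → MvPolynomial (Fin (n + 1)) k}
    (hω : ∀ i, (ω i).IsHomogeneous (d + 1)) (i : Fin (n + 1)) :
    map (evalAt d ω) (univForm k n d i) = ω i := by
  classical
  ext c
  simp only [univForm, map_sum, map_monomial, evalAt, eval_X, coeff_sum, coeff_monomial]
  by_cases hc : Multiset.card (Finsupp.toMultiset c) = d + 1
  · rw [Finset.sum_eq_single ⟨Finsupp.toMultiset c, hc⟩]
    · simp
    · intro s _ hs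
      rw [if_neg]
      rintro rfl
      exact hs (Subtype.ext (Multiset.toFinsupp_toMultiset _).symm)
    · exact fun h => absurd (Finset.mem_univ _) h
  · rw [Finset.sum_eq_zero, (hω i).coeff_eq_zero]
    · rw [Finsupp.card_toMultiset] at hc
      rwa [Finsupp.degree_apply]
    · intro s _
      rw [if_neg]
      rintro rfl
      exact hc (by rw [Multiset.toFinsupp_toMultiset]; exact s.2)

theorem map_contractRadial {R S : Type u} [CommRing R] [CommRing S] (φ : R →+* S)
    (ω : Fin (n + 1) → MvPolynomial (Fin (n + 1)) R) :
    map φ (contractRadial ω) = contractRadial fun i => map φ (ω i) := by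
  simp [contractRadial]

theorem map_extDeriv {R S : Type u} [CommRing R] [CommRing S] (φ : R →+* S)
    (ω : Fin (n + 1) → MvPolynomial (Fin (n + 1)) R) (i j : Fin (n + 1)) :
    map φ (extDeriv ω i j) = extDeriv (fun i => map φ (ω i)) i j := by
  simp [extDeriv, pderiv_map]

/-- Used in contrapositive form: a function that is nonzero at one closed projective form lies
outside the ideal of closed forms. -/
theorem closedIdeal_le_ker_evalAt {ω : Fin (n + 1) → MvPolynomial (Fin (n + 1)) k}
    (hω : ∀ i, (ω i).IsHomogeneous (d + 1)) (hr : contractRadial ω = 0)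
    (hc : ∀ i j, extDeriv ω i j = 0) :
    (closedIdeal k n d).toIdeal ≤ RingHom.ker (evalAt d ω) := by
  refine Ideal.span_le.2 ?_
  rintro _ (⟨c, rfl⟩ | ⟨i, j, c, rfl⟩) <;>
    rw [SetLike.mem_coe, RingHom.mem_ker, ← coeff_map]
  · rw [map_contractRadial, funext (map_evalAt_univForm hω), hr, coeff_zero]
  · rw [map_extDeriv, funext (map_evalAt_univForm hω), hc, coeff_zero]

theorem isPrime_closedIdeal : (closedIdeal k n d).toIdeal.IsPrime := by
  refine isPrime_span_of_isHomogeneous_one ?_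
  rintro _ (⟨c, rfl⟩ | ⟨i, j, c, rfl⟩)
  · exact coeffHomog_contractRadial c
  · exact coeffHomog_extDeriv i j c

theorem integrableIdeal_le_closedIdeal :
    (integrableIdeal k n d).toIdeal ≤ (closedIdeal k n d).toIdeal := by
  classical
  refine Ideal.span_le.2 ?_
  rintro _ (⟨c, rfl⟩ | ⟨i, j, l, c, rfl⟩)
  · exact Ideal.subset_span (Or.inl ⟨c, rfl⟩)
  · have h : ∀ i j l c, coeff c (univForm k n d i * extDeriv (univForm k n d) j l) ∈
        (closedIdeal k n d).toIdeal := fun i j l c => by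
      rw [coeff_mul]
      exact Ideal.sum_mem _ fun x _ => Ideal.mul_mem_left _ _
        (Ideal.subset_span (Or.inr ⟨j, l, x.2, rfl⟩))
    rw [wedgeExtDeriv, coeff_add, coeff_sub]
    exact add_mem (sub_mem (h _ _ _ _) (h _ _ _ _)) (h _ _ _ _)

theorem univForm_isHomogeneous (i : Fin (n + 1)) : (univForm k n d i).IsHomogeneous (d + 1) := by
  refine IsHomogeneous.sum _ _ _ fun s _ => isHomogeneous_monomial _ ?_
  have h := Multiset.toFinsupp_sum_eq (s : Multiset (Fin (n + 1)))
  rw [Finsupp.sum_fintype _ _ (fun _ => rfl)] at h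
  rw [Finsupp.degree_eq_sum]
  exact h.trans s.2

/-- At a triangular `1`-form, the integrability equations generate the ideal of closed forms after
inverting a single function. -/
theorem exists_mul_mem_integrableIdeal {ω : Fin (n + 1) → MvPolynomial (Fin (n + 1)) k}
    (hω : ∀ i, (ω i).IsHomogeneous (d + 1)) {i₀ i₁ i₂ i₃ : Fin (n + 1)}
    (ht : IsTriangular ω (d + 1) i₀ i₁ i₂ i₃) :
    ∃ δ, evalAt d ω δ ≠ 0 ∧
      ∀ a ∈ (closedIdeal k n d).toIdeal, δ * a ∈ (integrableIdeal k n d).toIdeal := by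
  have := Fintype.ofFinite (LowExp n d)
  obtain ⟨δ, hδ, hJ⟩ := exists_mul_mem_of_mulVec_mem (evalAt d ω)
    (wedgeTwoMatrix (univForm k n d) d) fun β hβ => by
      rw [wedgeTwoMatrix_map, funext (map_evalAt_univForm hω)] at hβ
      have hz := ht.eq_zero_of_wedgeTwo (θ := fun a b => ∑ s : LowExp n d, monomial s.1 (β (a, b, s)))
        (fun a b => Nat.lt_succ_of_le (totalDegree_sum_lowExp_le fun s => β (a, b, s))) fun i j l => by
          ext c
          rw [← wedgeTwoMatrix_mulVec, hβ]
          simp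
      funext ⟨a, b, s⟩
      rw [← coeff_sum_lowExp (fun s => β (a, b, s)) s, congrFun (congrFun hz a) b]
      simp
  refine ⟨δ, hδ, fun a ha => ?_⟩
  have hdeg : ∀ i j, (extDeriv (univForm k n d) i j).totalDegree ≤ d := fun i j =>
    (((univForm_isHomogeneous j).pderiv (i := i)).sub
      ((univForm_isHomogeneous i).pderiv (i := j))).totalDegree_le
  -- The matrix sends the coefficient vector of the universal `dω` to the coefficients of `ω ∧ dω`,
  -- which are generators of the integrable ideal.
  have hext : ∀ i j (s : LowExp n d), δ * coeff s.1 (extDeriv (univForm k n d) i j) ∈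
      (integrableIdeal k n d).toIdeal := fun i j s =>
    hJ _ (fun t => coeff t.2.2.1 (extDeriv (univForm k n d) t.1 t.2.1)) (fun ⟨i, j, l, c⟩ => by
      rw [wedgeTwoMatrix_mulVec]
      simp only [← eq_sum_lowExp_of_commRing _ (hdeg _ _)]
      exact Ideal.subset_span (Or.inr ⟨i, j, l, c, rfl⟩)) (i, j, s)
  have hle : (closedIdeal k n d).toIdeal ≤
      Submodule.comap (LinearMap.mulLeft (CoeffRing k n d) δ) (integrableIdeal k n d).toIdeal := by
    refine Ideal.span_le.2 ?_
    rintro a ha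
    change δ * a ∈ (integrableIdeal k n d).toIdeal
    obtain ⟨c, rfl⟩ | ⟨i, j, c, rfl⟩ := ha
    · exact Ideal.mul_mem_left _ _ (Ideal.subset_span (Or.inl ⟨c, rfl⟩))
    · by_cases hc : c.degree ≤ d
      · exact hext i j ⟨c, hc⟩
      -- Coefficients of `dω` in degree above `d` vanish identically.
      · rw [coeff_eq_zero_of_totalDegree_lt, mul_zero]
        · exact zero_mem _
        · rw [Finsupp.degree_apply] at hc
          exact (hdeg i j).trans_lt (not_le.1 hc)
  exact hle ha

/-- Allows specialization at an explicit form, not only at the residue field of a point. -/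
theorem wedgeMatrix_map_mulVec [Fintype (LowExp n d)] {K : Type u} [Field K]
    (φ : CoeffRing k n d →+* K) (β : Fin (n + 1) × LowExp n d → K)
    (i j : Fin (n + 1)) (c : Fin (n + 1) →₀ ℕ) :
    ((wedgeMatrix k n d).map φ).mulVec β (i, j, c) =
      coeff c (map φ (univForm k n d i) * (∑ s, monomial s.1 (β (j, s))) -
        map φ (univForm k n d j) * (∑ s, monomial s.1 (β (i, s)))) := by
  have key : ∀ l, ∑ s, monomial s.1 (β (l, s)) = ∑ t : Fin (n + 1) × LowExp n d,
      C (β t) * (if t.1 = l then monomial t.2.1 1 else 0) := by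
    intro l
    rw [Fintype.sum_prod_type, Finset.sum_eq_single l (fun x _ hx => by simp [hx]) (by simp)]
    simp [C_mul_monomial]
  simp only [key, Finset.mul_sum]
  rw [← Finset.sum_sub_distrib, coeff_sum]
  refine Finset.sum_congr rfl fun t _ => ?_
  change φ (coeff c _) * β t = _
  rw [mul_comm, ← coeff_map, ← coeff_C_mul]
  congr 1
  simp only [map_sub, apply_ite (map φ), map_mul, map_monomial, map_one, map_zero]
  split_ifs <;> ring

/-- At a triangular `1`-form, some maximal minor of `wedgeMatrix` does not vanish. -/
theorem exists_minor_wedgeMatrix_ne_zero [Fintype (LowExp n d)]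
    {ω : Fin (n + 1) → MvPolynomial (Fin (n + 1)) k}
    (hω : ∀ i, (ω i).IsHomogeneous (d + 1)) {i₀ i₁ i₂ i₃ : Fin (n + 1)}
    (ht : IsTriangular ω (d + 1) i₀ i₁ i₂ i₃) :
    ∃ f : Fin (n + 1) × LowExp n d → Fin (n + 1) × Fin (n + 1) × (Fin (n + 1) →₀ ℕ),
      evalAt d ω ((wedgeMatrix k n d).submatrix f id).det ≠ 0 := by
  obtain ⟨f, hf⟩ := (exists_minor_ne_zero ((wedgeMatrix k n d).map (evalAt d ω))).1 fun β hβ => by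
    have hz := ht.eq_zero_of_wedge (b := fun a => ∑ s : LowExp n d, monomial s.1 (β (a, s)))
      (fun a => Nat.lt_succ_of_le (totalDegree_sum_lowExp_le fun s => β (a, s))) fun i j => by
        ext c
        have := congrFun hβ (i, j, c)
        rwa [wedgeMatrix_map_mulVec, map_evalAt_univForm hω, map_evalAt_univForm hω] at this
    funext ⟨a, s⟩
    rw [← coeff_sum_lowExp (fun s => β (a, s)) s, congrFun hz a]
    simp
  exact ⟨f, by rwa [RingHom.map_det]⟩

end Specialization

/-! ### Points and local rings of closed subschemes of `Proj`. -/

section ClosedSub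
variable {k : Type u} [Field k] {A : Type u} [CommRing A] [Algebra k A]
  (𝒜 : ℕ → Submodule k A) [GradedAlgebra 𝒜] (I : HomogeneousIdeal 𝒜)

/-- The homogeneous prime ideal corresponding to a point of `Proj`. -/
def projIdeal (x : Proj 𝒜) : Ideal A :=
  (ProjectiveSpectrum.asHomogeneousIdeal (𝒜 := 𝒜) x).toIdeal

instance projIdeal_isPrime (x : Proj 𝒜) : (projIdeal 𝒜 x).IsPrime :=
  ProjectiveSpectrum.isPrime (𝒜 := 𝒜) x

theorem projIdeal_closedSubι (y : closedSub 𝒜 I) :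
    projIdeal 𝒜 (closedSubι 𝒜 I y) =
      (projIdeal (quotGrading 𝒜 I) y).comap (Ideal.Quotient.mk I.toIdeal) := rfl

theorem projIdeal_injective : Function.Injective (projIdeal 𝒜) := fun _ _ h =>
  ProjectiveSpectrum.ext (𝒜 := 𝒜) (HomogeneousIdeal.ext h)

theorem le_projIdeal_closedSubι (y : closedSub 𝒜 I) :
    I.toIdeal ≤ projIdeal 𝒜 (closedSubι 𝒜 I y) := fun a ha => by
  rw [projIdeal_closedSubι, Ideal.mem_comap, Ideal.Quotient.eq_zero_iff_mem.2 ha]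
  exact zero_mem _

theorem exists_closedSubι_eq {x : Proj 𝒜} (hx : I.toIdeal ≤ projIdeal 𝒜 x) :
    ∃ y, closedSubι 𝒜 I y = x := by
  have hc : ((projIdeal 𝒜 x).map (Ideal.Quotient.mk I.toIdeal)).comap
      (Ideal.Quotient.mk I.toIdeal) = projIdeal 𝒜 x := by
    rw [Ideal.comap_map_of_surjective _ Ideal.Quotient.mk_surjective]
    refine sup_eq_left.2 fun a ha => hx ?_
    exact Ideal.Quotient.eq_zero_iff_mem.1 ha
  let y : ProjectiveSpectrum (quotGrading 𝒜 I) :=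
    { asHomogeneousIdeal :=
        HomogeneousIdeal.map (quotMap 𝒜 I) (ProjectiveSpectrum.asHomogeneousIdeal (𝒜 := 𝒜) x)
      isPrime := Ideal.map_isPrime_of_surjective (f := Ideal.Quotient.mk I.toIdeal)
        (I := projIdeal 𝒜 x) Ideal.Quotient.mk_surjective (by rwa [Ideal.mk_ker])
      not_irrelevant_le := fun h => ProjectiveSpectrum.not_irrelevant_le (𝒜 := 𝒜) x <| by
        rw [HomogeneousIdeal.irrelevant_le]
        intro i hi a ha
        have h1 := h (HomogeneousIdeal.mem_irrelevant_of_mem (quotGrading 𝒜 I) hi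
          (⟨a, ha, rfl⟩ : Ideal.Quotient.mk I.toIdeal a ∈ quotGrading 𝒜 I i))
        exact hc.le h1 }
  exact ⟨y, projIdeal_injective 𝒜 hc⟩

theorem range_closedSubι :
    Set.range (closedSubι 𝒜 I) = {x | I.toIdeal ≤ projIdeal 𝒜 x} := by
  ext x
  constructor
  · rintro ⟨y, rfl⟩
    exact le_projIdeal_closedSubι 𝒜 I y
  · exact exists_closedSubι_eq 𝒜 I

theorem mem_closure_singleton_iff (x y : Proj 𝒜) :
    y ∈ closure ({x} : Set (Proj 𝒜)) ↔ projIdeal 𝒜 x ≤ projIdeal 𝒜 y :=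
  (ProjectiveSpectrum.le_iff_mem_closure (𝒜 := 𝒜) x y).symm

/-- A local ring of `Proj A` is reduced if so is the corresponding localization of `A`. -/
theorem isReduced_stalk (x : Proj 𝒜) [_root_.IsReduced (Localization.AtPrime (projIdeal 𝒜 x))] :
    _root_.IsReduced ((Proj 𝒜).presheaf.stalk x) := by
  have h1 : _root_.IsReduced (HomogeneousLocalization.AtPrime 𝒜 (projIdeal 𝒜 x)) :=
    isReduced_of_injective
      (algebraMap (HomogeneousLocalization.AtPrime 𝒜 (projIdeal 𝒜 x))
        (Localization.AtPrime (projIdeal 𝒜 x))) (HomogeneousLocalization.val_injective _)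
  let f : (Proj 𝒜).presheaf.stalk x ≃+* HomogeneousLocalization.AtPrime 𝒜 (projIdeal 𝒜 x) :=
    (Proj.stalkIso 𝒜 x).commRingCatIsoToRingEquiv
  exact isReduced_of_injective f f.injective

/-- If an element outside of a prime `P` multiplies a prime ideal `N` into `I ≤ N`, then the
localization of `A / I` at `P` is reduced. -/
theorem isReduced_localization_quotient {A : Type*} [CommRing A] {I N : Ideal A} [N.IsPrime]
    (hIN : I ≤ N) {δ : A} (hδ : ∀ a ∈ N, δ * a ∈ I) (P : Ideal (A ⧸ I)) [P.IsPrime]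
    (hP : Ideal.Quotient.mk I δ ∉ P) : _root_.IsReduced (Localization.AtPrime P) := by
  have hNP : ∀ a ∈ N, Ideal.Quotient.mk I a ∈ P := fun a ha => by
    refine (Ideal.IsPrime.mem_or_mem ‹_› (x := Ideal.Quotient.mk I δ) ?_).resolve_left hP
    rw [← map_mul, Ideal.Quotient.eq_zero_iff_mem.2 (hδ a ha)]
    exact zero_mem _
  constructor
  rintro z ⟨m, hm⟩
  obtain ⟨a, s, rfl⟩ := IsLocalization.exists_mk'_eq P.primeCompl z
  obtain ⟨a, rfl⟩ := Ideal.Quotient.mk_surjective a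
  rw [← IsLocalization.mk'_pow, IsLocalization.mk'_eq_zero_iff] at hm
  obtain ⟨⟨t, ht⟩, h⟩ := hm
  obtain ⟨t, rfl⟩ := Ideal.Quotient.mk_surjective t
  simp only [← map_pow, ← map_mul, Ideal.Quotient.eq_zero_iff_mem] at h
  -- A nilpotent fraction `a / s` satisfies `t * a ^ m ∈ I ≤ N` with `t ∉ N`, so `a ∈ N` and the
  -- unit `δ` kills it.
  have ha : a ∈ N := Ideal.IsPrime.mem_of_pow_mem ‹_› m
    ((Ideal.IsPrime.mem_or_mem ‹_› (hIN h)).resolve_left fun htN => ht (hNP t htN))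
  rw [IsLocalization.mk'_eq_zero_iff]
  refine ⟨⟨Ideal.Quotient.mk I δ, hP⟩, ?_⟩
  simp only [← map_mul, Ideal.Quotient.eq_zero_iff_mem]
  exact hδ a ha

end ClosedSub

/-! ### Topology and local rings of `Fol` along the closed foliations. -/

section Main
open MvPolynomial
variable {k : Type u} [Field k] {n d : ℕ}

theorem mem_closedFoliations_iff (x : Fol k n d) :
    x ∈ closedFoliations k n d ↔ (closedIdeal k n d).toIdeal ≤ pointIdeal (Folι k n d x) := by
  change Folι k n d x ∈ Set.range (closedFormSpaceι k n d) ↔ _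
  rw [closedFormSpaceι, range_closedSubι]
  rfl

theorem range_Folι : Set.range (Folι k n d) =
    {x | (integrableIdeal k n d).toIdeal ≤ pointIdeal x ∧ x ∈ saturatedSet k n d} := by
  ext x
  constructor
  · rintro ⟨y, rfl⟩
    exact ⟨le_projIdeal_closedSubι _ _ y.1, y.2⟩
  · rintro ⟨h1, h2⟩
    obtain ⟨y, rfl⟩ := exists_closedSubι_eq (coeffGrading k n d) (integrableIdeal k n d) h1
    exact ⟨⟨y, h2⟩, rfl⟩

/-- The locus of `Fol` where a polynomial function does not vanish. -/
def folBasicOpen (δ : CoeffRing k n d) : (Fol k n d).Opens :=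
  Folι k n d ⁻¹ᵁ Proj.basicOpen (coeffGrading k n d) δ

theorem mem_folBasicOpen (δ : CoeffRing k n d) (x : Fol k n d) :
    x ∈ folBasicOpen δ ↔ δ ∉ pointIdeal (Folι k n d x) := Iff.rfl

/-- Closed forms are integrable, so both sides consist of the saturated points that satisfy the
closed equations. -/
theorem image_closedFoliations :
    Folι k n d '' closedFoliations k n d = closedFormSpaceι k n d ''
      (closedFormSpaceι k n d ⁻¹ᵁ saturatedLocus k n d : (closedFormSpace k n d).Opens) := by
  have hW : ((closedFormSpaceι k n d ⁻¹ᵁ saturatedLocus k n d : (closedFormSpace k n d).Opens) :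
      Set (closedFormSpace k n d)) = closedFormSpaceι k n d ⁻¹' saturatedSet k n d := rfl
  rw [hW, Set.image_preimage_eq_inter_range, closedFoliations, Set.image_preimage_eq_inter_range,
    range_Folι, closedFormSpaceι, range_closedSubι]
  ext x
  exact ⟨fun ⟨h1, h2⟩ => ⟨h2.2, h1⟩,
    fun ⟨h1, h2⟩ => ⟨h2, integrableIdeal_le_closedIdeal.trans h2, h1⟩⟩

/-- Specialization passes to an open subscheme, and ideals of a quotient are compared through their
preimages in `CoeffRing`. -/
theorem mem_fol_closure_singleton_iff (x y : Fol k n d) :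
    y ∈ closure ({x} : Set (Fol k n d)) ↔
      pointIdeal (Folι k n d x) ≤ pointIdeal (Folι k n d y) := by
  let U := closedSubι (coeffGrading k n d) (integrableIdeal k n d) ⁻¹ᵁ saturatedLocus k n d
  have hU : Topology.IsInducing U.ι := U.ι.isOpenEmbedding.isInducing
  rw [hU.closure_eq_preimage_closure_image, Set.image_singleton, Set.mem_preimage]
  refine (mem_closure_singleton_iff _ _ _).trans ?_
  exact (Ideal.comap_le_comap_iff_of_surjective (Ideal.Quotient.mk (integrableIdeal k n d).toIdeal)
    Ideal.Quotient.mk_surjective _ _).symm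

/-- If the ideals of closed and of integrable forms agree after inverting some `δ`, and `δ` does not
vanish at the generic closed form, then the closed forms make up an irreducible component. -/
theorem closedFoliations_mem_irreducibleComponents {δ : CoeffRing k n d}
    (hδ : ∀ a ∈ (closedIdeal k n d).toIdeal, δ * a ∈ (integrableIdeal k n d).toIdeal)
    {ξ : Fol k n d} (hξ : pointIdeal (Folι k n d ξ) = (closedIdeal k n d).toIdeal)
    (hξδ : ξ ∈ folBasicOpen δ) :
    closedFoliations k n d ∈ irreducibleComponents (Fol k n d) := by
  have hcl : closedFoliations k n d = closure {ξ} := by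
    ext x
    rw [mem_closedFoliations_iff, mem_fol_closure_singleton_iff, hξ]
  have hsub : ∀ x ∈ folBasicOpen δ, x ∈ closedFoliations k n d := fun x hx => by
    rw [mem_closedFoliations_iff]
    intro a ha
    refine ((pointIdeal_isPrime (Folι k n d x)).mem_or_mem ?_).resolve_left hx
    exact le_projIdeal_closedSubι _ _ x.1 (hδ a ha)
  refine ⟨hcl ▸ isIrreducible_singleton.closure, fun S hS hle => ?_⟩
  -- An irreducible `S` is contained in the closure of its trace on the open set `δ ≠ 0`, and this
  -- trace consists of closed foliations.
  have hne : (S ∩ (folBasicOpen δ : Set (Fol k n d))).Nonempty :=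
    ⟨ξ, hle (hcl ▸ subset_closure rfl), hξδ⟩
  refine (subset_closure_inter_of_isPreirreducible_of_isOpen hS.isPreirreducible
    (folBasicOpen δ).isOpen hne).trans (closure_minimal (fun x hx => hsub x hx.2) ?_)
  rw [hcl]
  exact isClosed_closure

theorem isReduced_stalk_of_mem_folBasicOpen {δ : CoeffRing k n d}
    (hδ : ∀ a ∈ (closedIdeal k n d).toIdeal, δ * a ∈ (integrableIdeal k n d).toIdeal)
    {x : Fol k n d} (hx : x ∈ folBasicOpen δ) :
    _root_.IsReduced ((Fol k n d).presheaf.stalk x) := by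
  have := isPrime_closedIdeal (k := k) (n := n) (d := d)
  let U := closedSubι (coeffGrading k n d) (integrableIdeal k n d) ⁻¹ᵁ saturatedLocus k n d
  have h1 : _root_.IsReduced (Localization.AtPrime
      (projIdeal (quotGrading (coeffGrading k n d) (integrableIdeal k n d)) x.1)) :=
    isReduced_localization_quotient integrableIdeal_le_closedIdeal hδ _ hx
  have h2 := isReduced_stalk (quotGrading (coeffGrading k n d) (integrableIdeal k n d)) x.1
  exact isReduced_of_injective (U.stalkIso x).commRingCatIsoToRingEquiv (RingEquiv.injective _)

end Main

/-! ### The generic closed foliation. -/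

section GenericPoint
open MvPolynomial
variable {k : Type u} [Field k] {n d : ℕ}

/-- The ideal of closed forms is the ideal of a point of `Fol`, if there is a closed projective
`1`-form with triangular coefficients. -/
theorem exists_pointIdeal_eq_closedIdeal {ω : Fin (n + 1) → MvPolynomial (Fin (n + 1)) k}
    (hω : ∀ i, (ω i).IsHomogeneous (d + 1)) (hr : contractRadial ω = 0)
    (hc : ∀ i j, extDeriv ω i j = 0) {i₀ i₁ i₂ i₃ : Fin (n + 1)}
    (ht : IsTriangular ω (d + 1) i₀ i₁ i₂ i₃) :
    ∃ ξ : Fol k n d, pointIdeal (Folι k n d ξ) = (closedIdeal k n d).toIdeal := by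
  have := Fintype.ofFinite (LowExp n d)
  have hker := closedIdeal_le_ker_evalAt hω hr hc
  let x : ProjectiveSpectrum (coeffGrading k n d) :=
    { asHomogeneousIdeal := closedIdeal k n d
      isPrime := isPrime_closedIdeal
      -- If every variable lay in the ideal, all coefficients of `ω` would vanish, contrary to `ω i₃
      -- ≠ 0`.
      not_irrelevant_le := fun h => ht.ne_zero <| by
        have hX : ∀ v, evalAt d ω (X v) = 0 := fun v => hker <| h <|
          HomogeneousIdeal.mem_irrelevant_of_mem (coeffGrading k n d) one_pos
            (isHomogeneous_X k v)
        rw [← map_evalAt_univForm hω i₃, univForm, map_sum]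
        exact Finset.sum_eq_zero fun s _ => by rw [map_monomial, hX, monomial_zero] }
  have hx : x ∈ saturatedSet k n d := by
    obtain ⟨f, hf⟩ := exists_minor_wedgeMatrix_ne_zero hω ht
    exact (mem_saturatedSet_iff x).2 ⟨f, fun h => hf (hker h)⟩
  obtain ⟨ξ, hξ⟩ : x ∈ Set.range (Folι k n d) := by
    rw [range_Folι]
    exact ⟨integrableIdeal_le_closedIdeal, hx⟩
  exact ⟨ξ, congrArg pointIdeal hξ⟩

end GenericPoint

end
end Foliation
theorem mainTheorem5 (k : Type*) [Field k] [IsAlgClosed k] (p : ℕ) [Fact p.Prime] [CharP k p]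
    (n e d : ℕ) (hn : 3 ≤ n) (he : 1 ≤ e) (hd : d + 2 = p * e) :
    Foliation.closedFoliations k n d ∈ irreducibleComponents (Foliation.Fol k n d) ∧
    (∃ W : (Foliation.closedFormSpace k n d).Opens,
      Foliation.Folι k n d '' Foliation.closedFoliations k n d =
        Foliation.closedFormSpaceι k n d '' (W : Set (Foliation.closedFormSpace k n d))) ∧
    ∃ U : (Foliation.Fol k n d).Opens,
      ((U : Set (Foliation.Fol k n d)) ∩ Foliation.closedFoliations k n d).Nonempty ∧
      ∀ x ∈ U, _root_.IsReduced ((Foliation.Fol k n d).presheaf.stalk x) := by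
  open Foliation in
  -- The example needs four distinct variables, hence `n ≥ 3`.
  let i : Fin 4 → Fin (n + 1) := Fin.castLE (by omega)
  have hf := chainPoly_isHomogeneous (R := k) (d + 1) i
  have hω : ∀ j, (MvPolynomial.pderiv j (chainPoly k (d + 1) i)).IsHomogeneous (d + 1) :=
    fun _ => hf.pderiv
  -- The degree of the polynomial is `d + 2 = p * e`, which is zero in `k`.
  have hr := contractRadial_pderiv hf (by
    rw [add_assoc, one_add_one_eq_two, hd, Nat.cast_mul, CharP.cast_eq_zero, zero_mul])
  have hc := extDeriv_pderiv (chainPoly k (d + 1) i)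
  have ht := isTriangular_chainPoly (R := k) d.succ_pos
    (Fin.castLE_injective (by omega) : i.Injective)
  obtain ⟨δ, hδ, hJ⟩ := exists_mul_mem_integrableIdeal hω ht
  obtain ⟨ξ, hξ⟩ := exists_pointIdeal_eq_closedIdeal hω hr hc ht
  have hξδ : ξ ∈ folBasicOpen δ := by
    rw [mem_folBasicOpen, hξ]
    exact fun h => hδ (closedIdeal_le_ker_evalAt hω hr hc h)
  exact ⟨closedFoliations_mem_irreducibleComponents hJ hξ hξδ, ⟨_, image_closedFoliations⟩,
    folBasicOpen δ, ⟨ξ, hξδ, (mem_closedFoliations_iff ξ).2 hξ.ge⟩,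
    fun x hx => isReduced_stalk_of_mem_folBasicOpen hJ hx⟩
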